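/- Let $\mathcal A$ be a (skeletally small) abelian category. For an abelian category $\mathcal C$, let $\mathsf M(\mathcal C)$ be its Grothendieck monoid, i.e. the commutative monoid generated by symbols $[X]$ for the objects $X$ of $\mathcal C$, subject to $[0]=0$ and $[Y]=[X]+[Z]$ for every short exact sequence $0\to X\to Y\to Z\to 0$; an exact functor $F$ induces $\mathsf M(F)\colon [X]\mapsto[FX]$. Let $\mathsf{Serre}(\mathcal A)$ be the set of Serre subcategories of $\mathcal A$, with the topology whose closed subsets are the sets $V(\mathcal X)=\{\mathcal S\mid \mathcal S\cap\mathcal X=\emptyset\}$ for arbitrary families $\mathcal X$ of objects. For $X\in\mathcal A$ put $U_X=\{\mathcal S\mid X\in\mathcal S\}$, let $\langle X\rangle_{\mathsf{Serre}}$ be the smallest Serre subcategory containing $X$, and let $\mathcal A/\mathcal S$ be the abelian quotient category of $\mathcal A$ by a Serre subcategory $\mathcal S$. A space is called strongly quasi-compact if every open covering of it has a member equal to the whole space. The strongly quasi-compact open subsets of $\mathsf{Serre}(\mathcal A)$ are exactly the sets $U_X$ ($X\in\mathcal A$), and they form a basis of the topology. If $U_Y\subseteq U_X$ then $\langle X\rangle_{\mathsf{Serre}}\subseteq\langle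 Y\rangle_{\mathsf{Serre}}$, and the induced exact functors $\mathcal A/\langle X\rangle_{\mathsf{Serre}}\to\mathcal A/\langle Y\rangle_{\mathsf{Serre}}$ make $U_X\mapsto\mathsf M(\mathcal A/\langle X\rangle_{\mathsf{Serre}})$ a presheaf of commutative monoids on this basis. Define a presheaf $\mathcal M_{\mathcal A}$ on $\mathsf{Serre}(\mathcal A)$ by $$\mathcal M_{\mathcal A}(V)=\varprojlim_{U_X\subseteq V}\mathsf M(\mathcal A/\langle X\rangle_{\mathsf{Serre}}).$$ Then $\mathcal M_{\mathcal A}$ is a sheaf of commutative monoids, and the following hold. 1. $\mathcal M_{\mathcal A}$ extends the presheaf on the basis: the projections $\mathcal M_{\mathcal A}(U_X)\to\mathsf M(\mathcal A/\langle X\rangle_{\mathsf{Serre}})$ are isomorphisms for all $X\in\mathcal A$, compatible with restriction. 2. $\mathcal M_{\mathcal A}(\mathsf{Serre}(\mathcal A))\cong\mathsf M(\mathcal A)$; under this isomorphism the map from global sections to $\mathcal M_{\mathcal A}(U_X)=\mathsf M(\mathcal A/\langle X\rangle_{\mathsf{Serre}})$ is induced by the quotient functor. 3. For every point $\mathcal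 S\in\mathsf{Serre}(\mathcal A)$ there is an isomorphism from the stalk $\mathcal M_{\mathcal A,\mathcal S}$ to $\mathsf M(\mathcal A/\mathcal S)$ which, for each $X\in\mathcal S$, is compatible with the map $\mathsf M(\mathcal A/\langle X\rangle_{\mathsf{Serre}})\to\mathsf M(\mathcal A/\mathcal S)$ induced by the natural exact functor. -/

import Mathlib

universe v u v' u' w

open CategoryTheory CategoryTheory.Limits TopologicalSpace Opposite

/-! ### The Grothendieck monoid of an abelian category -/

/-- The generating relations of the Grothendieck monoid on the free commutative monoid
`Multiset C` on the objects: `[0] = 0`, and `[Y] = [X] + [Z]` for `0 ⟶ X ⟶ Y ⟶ Z ⟶ 0` exact.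
Isomorphic objects are identified by these relations (take `Z = 0`). -/
inductive GrothendieckMonoid.Rel (C : Type u) [Category.{v} C] [Abelian C] :
    Multiset C → Multiset C → Prop
  | zero (X : C) (hX : IsZero X) : GrothendieckMonoid.Rel C {X} 0
  | shortExact (S : ShortComplex C) (hS : S.ShortExact) :
      GrothendieckMonoid.Rel C {S.X₂} ({S.X₁} + {S.X₃})

/-- The Grothendieck monoid `M(C)` of an abelian category `C`. -/
def GrothendieckMonoid (C : Type u) [Category.{v} C] [Abelian C] : Type u :=
  (addConGen (GrothendieckMonoid.Rel C)).Quotient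

/-- A function on objects with values in a commutative monoid is additive if it vanishes on zero
objects and is additive on short exact sequences. (It is then constant on isomorphism classes.) -/
structure IsAdditiveFunction {C : Type u} [Category.{v} C] [Abelian C] {M : Type w}
    [AddCommMonoid M] (f : C → M) : Prop where
  zero : ∀ X : C, IsZero X → f X = 0
  shortExact : ∀ S : ShortComplex C, S.ShortExact → f S.X₂ = f S.X₁ + f S.X₃

namespace GrothendieckMonoid

variable {C : Type u} [Category.{v} C] [Abelian C]

noncomputable instance : AddCommMonoid (GrothendieckMonoid C) :=
  inferInstanceAs (AddCommMonoid (addConGen (GrothendieckMonoid.Rel C)).Quotient)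

/-- The class `[X]` of an object `X`. -/
def of (X : C) : GrothendieckMonoid C :=
  (addConGen (GrothendieckMonoid.Rel C)).mk' {X}

theorem of_isAdditive : IsAdditiveFunction (of : C → GrothendieckMonoid C) where
  zero X hX := (AddCon.eq _).2 (AddConGen.Rel.of _ _ (Rel.zero X hX))
  shortExact S hS := (AddCon.eq _).2 (AddConGen.Rel.of _ _ (Rel.shortExact S hS))

/-- The homomorphism out of `M(C)` induced by an additive function. -/
noncomputable def lift {M : Type w} [AddCommMonoid M] (f : C → M) (hf : IsAdditiveFunction f) :
    GrothendieckMonoid C →+ M :=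
  (addConGen (GrothendieckMonoid.Rel C)).lift
    (Multiset.sumAddMonoidHom.comp (Multiset.mapAddMonoidHom f)) (by
      refine AddCon.addConGen_le.2 fun x y h => ?_
      cases h with
      | zero X hX => simp [AddCon.ker_rel, hf.zero X hX]
      | shortExact S hS => simp [AddCon.ker_rel, hf.shortExact S hS])

theorem lift_of {M : Type w} [AddCommMonoid M] (f : C → M) (hf : IsAdditiveFunction f) (X : C) :
    lift f hf (of X) = f X := by
  refine (AddCon.lift_mk' _ _).trans ?_
  simp

theorem hom_ext {M : Type w} [AddCommMonoid M] {f g : GrothendieckMonoid C →+ M}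
    (h : ∀ X, f (of X) = g (of X)) : f = g := by
  refine AddCon.hom_ext ?_
  exact Multiset.addHom_ext h

/-- The homomorphism `M(F) : M(C) → M(D)`, `[X] ↦ [F X]`, induced by an exact functor `F`. -/
noncomputable def map {D : Type u'} [Category.{v'} D] [Abelian D] (F : C ⥤ D)
    [PreservesFiniteLimits F] [PreservesFiniteColimits F] :
    GrothendieckMonoid C →+ GrothendieckMonoid D :=
  lift (fun X => of (F.obj X))
    { zero := fun _ hX => of_isAdditive.zero _ (F.map_isZero hX)
      shortExact := fun S hS => of_isAdditive.shortExact (S.map F) (hS.map_of_exact F) }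

theorem map_of {D : Type u'} [Category.{v'} D] [Abelian D] (F : C ⥤ D)
    [PreservesFiniteLimits F] [PreservesFiniteColimits F] (X : C) :
    map F (of X) = of (F.obj X) :=
  lift_of _ _ X

end GrothendieckMonoid

/-! ### The space of Serre subcategories and Serre quotients -/

/-- The type `Serre(A)` of Serre subcategories of an abelian category `A`. -/
@[ext]
structure Serre (A : Type u) [Category.{v} A] [Abelian A] : Type u where
  /-- membership of objects in the subcategory -/
  prop : ObjectProperty A
  isSerreClass : prop.IsSerreClass

/-- A topological space is strongly quasi-compact if every open covering of it has a member
that is already the whole space. -/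
def IsStronglyQuasiCompactSpace (X : Type u) [TopologicalSpace X] : Prop :=
  ∀ 𝒰 : Set (Set X), (∀ U ∈ 𝒰, IsOpen U) → ⋃₀ 𝒰 = Set.univ → Set.univ ∈ 𝒰

namespace Serre

variable {A : Type u} [Category.{v} A] [Abelian A]

instance (S : Serre A) : S.prop.IsSerreClass := S.isSerreClass

/-- `V(𝒳)`: the Serre subcategories containing no object of `𝒳`. -/
def zeroLocus (𝒳 : ObjectProperty A) : Set (Serre A) :=
  {S | ∀ X, 𝒳 X → ¬ S.prop X}

/-- The Zariski topology, whose closed subsets are the `V(𝒳)`. As Serre subcategories are closed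
under isomorphisms, it does not matter whether the `𝒳` are required to be so. -/
instance : TopologicalSpace (Serre A) :=
  TopologicalSpace.ofClosed (Set.range (zeroLocus (A := A)))
    ⟨fun _ => True, Set.eq_empty_of_forall_notMem fun S hS =>
      hS _ trivial (S.prop.prop_of_isZero (isZero_zero A))⟩
    (by
      intro 𝒱 h𝒱
      refine ⟨fun X => ∃ 𝒳 : ObjectProperty A, zeroLocus 𝒳 ∈ 𝒱 ∧ 𝒳 X, ?_⟩
      ext S
      refine ⟨fun hS V hV => ?_, fun hS X ⟨𝒳, h𝒳, hX⟩ => hS _ h𝒳 X hX⟩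
      obtain ⟨𝒳, rfl⟩ := h𝒱 hV
      exact fun X hX => hS X ⟨𝒳, hV, hX⟩)
    (by
      rintro _ ⟨𝒳, rfl⟩ _ ⟨𝒴, rfl⟩
      refine ⟨fun Z => ∃ X Y, 𝒳 X ∧ 𝒴 Y ∧ Z = (X ⊞ Y), ?_⟩
      ext S
      constructor
      · intro hS
        by_contra hcon
        simp only [Set.mem_union, zeroLocus, Set.mem_ofPred_eq, not_or, not_forall, not_not] at hcon
        obtain ⟨⟨X, hX, hX'⟩, Y, hY, hY'⟩ := hcon
        exact hS _ ⟨X, Y, hX, hY, rfl⟩ (S.prop.prop_X₂_of_shortExact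
          (ShortComplex.Splitting.ofHasBinaryBiproduct X Y).shortExact hX' hY')
      · rintro hS _ ⟨X, Y, hX, hY, rfl⟩ hXY
        rcases hS with hS | hS
        · exact hS X hX (S.prop.prop_of_mono (biprod.inl : X ⟶ X ⊞ Y) hXY)
        · exact hS Y hY (S.prop.prop_of_mono (biprod.inr : Y ⟶ X ⊞ Y) hXY))

theorem isClosed_iff (V : Set (Serre A)) : IsClosed V ↔ ∃ 𝒳, zeroLocus 𝒳 = V := by
  rw [← isOpen_compl_iff]
  change Vᶜᶜ ∈ _ ↔ _
  rw [compl_compl]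
  rfl

/-- The basic open subset `U_X = {S | X ∈ S}`. -/
def basicOpen (X : A) : Opens (Serre A) where
  carrier := {S | S.prop X}
  is_open' := by
    rw [← isClosed_compl_iff, isClosed_iff]
    refine ⟨fun Y => Y = X, ?_⟩
    ext S
    simp [zeroLocus]

/-- `⟨X⟩_Serre`: the smallest Serre subcategory containing `X`. -/
def span (X : A) : Serre A where
  prop Y := ∀ S : Serre A, S.prop X → S.prop Y
  isSerreClass :=
    { exists_zero := ⟨_, isZero_zero A, fun S _ => S.prop.prop_of_isZero (isZero_zero A)⟩
      prop_of_mono := fun f _ hY S hS => S.prop.prop_of_mono f (hY S hS)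
      prop_of_epi := fun f _ hX S hS => S.prop.prop_of_epi f (hX S hS)
      prop_X₂_of_shortExact := fun hE h₁ h₃ S hS =>
        S.prop.prop_X₂_of_shortExact hE (h₁ S hS) (h₃ S hS) }

theorem mem_span (X : A) : (span X).prop X := fun _ hS => hS

theorem span_le {X : A} {S : Serre A} (hS : S.prop X) : (span X).prop ≤ S.prop :=
  fun _ hY => hY S hS

theorem span_le_span {X Y : A} (h : basicOpen Y ≤ basicOpen X) : (span X).prop ≤ (span Y).prop :=
  span_le (S := span Y) (h (show span Y ∈ basicOpen Y from mem_span Y))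

/-- The abelian quotient category `A/S`: the localization of `A` at the morphisms whose kernel and
cokernel belong to `S`. -/
abbrev AbQuot (S : Serre A) : Type u := S.prop.isoModSerre.Localization

/-- The quotient functor `A ⥤ A/S`. -/
abbrev quotFunctor (S : Serre A) : A ⥤ S.AbQuot := S.prop.isoModSerre.Q

noncomputable instance (S : Serre A) : Abelian S.AbQuot :=
  ObjectProperty.SerreClassLocalization.abelian S.quotFunctor S.prop

instance (S : Serre A) : PreservesFiniteLimits S.quotFunctor :=
  ObjectProperty.SerreClassLocalization.preservesFiniteLimits S.quotFunctor S.prop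

instance (S : Serre A) : PreservesFiniteColimits S.quotFunctor :=
  ObjectProperty.SerreClassLocalization.preservesFiniteColimits S.quotFunctor S.prop

theorem isInvertedBy_quotFunctor {S T : Serre A} (h : S.prop ≤ T.prop) :
    S.prop.isoModSerre.IsInvertedBy T.quotFunctor := fun _ _ f hf =>
  Localization.inverts T.quotFunctor T.prop.isoModSerre f ⟨h _ hf.1, h _ hf.2⟩

/-- For `S ⊆ T`, the functor `A/S ⥤ A/T` induced by the universal property of `A/S`. -/
noncomputable def quotMap {S T : Serre A} (h : S.prop ≤ T.prop) : S.AbQuot ⥤ T.AbQuot :=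
  Localization.Construction.lift T.quotFunctor (isInvertedBy_quotFunctor h)

theorem quotFunctor_comp_quotMap {S T : Serre A} (h : S.prop ≤ T.prop) :
    S.quotFunctor ⋙ quotMap h = T.quotFunctor :=
  Localization.Construction.fac _ _

instance {S T : Serre A} (h : S.prop ≤ T.prop) : PreservesFiniteLimits (quotMap h) := by
  rw [← ObjectProperty.SerreClassLocalization.preservesFiniteLimits_comp_iff
    S.quotFunctor S.prop (quotMap h), quotFunctor_comp_quotMap]
  infer_instance

instance {S T : Serre A} (h : S.prop ≤ T.prop) : PreservesFiniteColimits (quotMap h) := by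
  rw [← ObjectProperty.SerreClassLocalization.preservesFiniteColimits_comp_iff
    S.quotFunctor S.prop (quotMap h), quotFunctor_comp_quotMap]
  infer_instance

/-- The homomorphism `M(A/S) → M(A/T)` induced by the exact functor `A/S ⥤ A/T`, for `S ⊆ T`. -/
noncomputable def monoidMap {S T : Serre A} (h : S.prop ≤ T.prop) :
    GrothendieckMonoid S.AbQuot →+ GrothendieckMonoid T.AbQuot :=
  GrothendieckMonoid.map (quotMap h)

theorem obj_surjective (S : Serre A) (X : S.AbQuot) : ∃ Y : A, S.quotFunctor.obj Y = X :=
  ⟨X.as.obj, rfl⟩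

theorem monoidMap_of {S T : Serre A} (h : S.prop ≤ T.prop) (X : A) :
    monoidMap h (.of (S.quotFunctor.obj X)) = .of (T.quotFunctor.obj X) :=
  GrothendieckMonoid.map_of _ _

theorem monoidMap_self (S : Serre A) : monoidMap (le_refl S.prop) = AddMonoidHom.id _ := by
  refine GrothendieckMonoid.hom_ext fun X => ?_
  obtain ⟨Y, rfl⟩ := obj_surjective S X
  exact monoidMap_of _ Y

theorem monoidMap_comp {S T R : Serre A} (h : S.prop ≤ T.prop) (h' : T.prop ≤ R.prop) :
    (monoidMap h').comp (monoidMap h) = monoidMap (h.trans h') := by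
  refine GrothendieckMonoid.hom_ext fun X => ?_
  obtain ⟨Y, rfl⟩ := obj_surjective S X
  rw [AddMonoidHom.comp_apply, monoidMap_of, monoidMap_of, monoidMap_of]

/-! ### The sheaf of monoids on the space of Serre subcategories -/

variable (A)

/-- The basis `{U_X}` of `Serre(A)`, as a category: an object is an object `X` of `A`, standing
for the open subset `U_X`, and the morphisms `X ⟶ Y` are the inclusions `U_X ⊆ U_Y`. -/
abbrev Basis : Type u := InducedCategory (Opens (Serre A)) (basicOpen (A := A))

/-- The inclusion of the basis into the category of all open subsets, `X ↦ U_X`. -/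
abbrev basisInclusion : Basis A ⥤ Opens (TopCat.of (Serre A)) :=
  inducedFunctor (basicOpen (A := A))

/-- The presheaf of monoids `U_X ↦ M(A/⟨X⟩_Serre)` on the basis; its restriction map for
`U_Y ⊆ U_X` is induced by the exact functor `A/⟨X⟩_Serre ⥤ A/⟨Y⟩_Serre`. -/
noncomputable def basisPresheaf : (Basis A)ᵒᵖ ⥤ AddCommMonCat.{u} where
  obj X := AddCommMonCat.of (GrothendieckMonoid (span (A := A) X.unop).AbQuot)
  map f := AddCommMonCat.ofHom (monoidMap (span_le_span f.unop.hom.le))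
  map_id X := by
    ext x
    exact DFunLike.congr_fun (monoidMap_self _) x
  map_comp f g := by
    ext x
    exact (DFunLike.congr_fun (monoidMap_comp _ _) x).symm

variable {A}

/-- The limit of `M(A/⟨X⟩_Serre)` over the basic open subsets `U_X ⊆ V`: the monoid of
compatible families. -/
def sections (V : Opens (Serre A)) :
    AddSubmonoid (∀ X : {X : A // basicOpen X ≤ V}, GrothendieckMonoid (span X.1).AbQuot) where
  carrier := {s | ∀ (X Y : {X : A // basicOpen X ≤ V}) (h : basicOpen Y.1 ≤ basicOpen X.1),
    monoidMap (span_le_span h) (s X) = s Y}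
  zero_mem' _ _ _ := map_zero _
  add_mem' hs ht X Y h := by
    simp only [Pi.add_apply, map_add, hs X Y h, ht X Y h]

/-- Restriction of compatible families. -/
def sectionsRestrict {V W : Opens (Serre A)} (h : W ≤ V) : sections V →+ sections W where
  toFun s := ⟨fun X => s.1 ⟨X.1, X.2.trans h⟩, 
    fun X Y hXY => s.2 ⟨X.1, X.2.trans h⟩ ⟨Y.1, Y.2.trans h⟩ hXY⟩
  map_zero' := Subtype.ext (funext fun _ => rfl)
  map_add' _ _ := Subtype.ext (funext fun _ => rfl)

variable (A)

/-- The presheaf of monoids `M_A` on `Serre(A)` extending `basisPresheaf A`, with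
`M_A(V) = lim M(A/⟨X⟩_Serre)` over the basic open subsets `U_X ⊆ V`. -/
noncomputable def monoidPresheaf : TopCat.Presheaf AddCommMonCat.{u} (TopCat.of (Serre A)) where
  obj V := AddCommMonCat.of (sections (A := A) V.unop)
  map f := AddCommMonCat.ofHom (sectionsRestrict f.unop.le)

/-- The canonical morphism from the restriction of `M_A` to the basis to the presheaf
`U_X ↦ M(A/⟨X⟩_Serre)`, given over `U_X` by the projection of the limit to its component
at `X`. -/
noncomputable def restrictionToBasis :
    (basisInclusion A).op ⋙ monoidPresheaf A ⟶ basisPresheaf A where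
  app X := AddCommMonCat.ofHom
    { toFun := fun s => s.1 ⟨X.unop, le_refl _⟩
      map_zero' := rfl
      map_add' := fun _ _ => rfl }
  naturality X Y f := by
    ext s
    exact (s.2 ⟨X.unop, le_refl _⟩ ⟨Y.unop, f.unop.hom.le⟩ f.unop.hom.le).symm

end Serre

/-! ### Colimits of commutative monoids (needed for stalks) -/

namespace AddCommMonColimit

variable {J : Type u} [SmallCategory J] (F : J ⥤ AddCommMonCat.{u})

/-- The relations defining the colimit of `F` on the free commutative monoid on all elements. -/
inductive Rel : Multiset (Σ j, F.obj j) → Multiset (Σ j, F.obj j) → Prop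
  | zero (j : J) : Rel {⟨j, 0⟩} 0
  | add (j : J) (x y : F.obj j) : Rel {⟨j, x + y⟩} ({⟨j, x⟩} + {⟨j, y⟩})
  | map {i j : J} (f : i ⟶ j) (x : F.obj i) : Rel {⟨j, F.map f x⟩} {⟨i, x⟩}

/-- The colimit cocone of `F`. -/
noncomputable def cocone : Cocone F where
  pt := AddCommMonCat.of (addConGen (Rel F)).Quotient
  ι :=
    { app := fun j => AddCommMonCat.ofHom
        { toFun := fun x => (addConGen (Rel F)).mk' {⟨j, x⟩}
          map_zero' := (AddCon.eq _).2 (AddConGen.Rel.of _ _ (Rel.zero j))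
          map_add' := fun x y => (AddCon.eq _).2 (AddConGen.Rel.of _ _ (Rel.add j x y)) }
      naturality := fun i j f => by
        ext x
        exact (AddCon.eq _).2 (AddConGen.Rel.of _ _ (Rel.map f x)) }

variable {F} in
/-- The homomorphism from the colimit of `F` to the point of a cocone. -/
noncomputable def desc (s : Cocone F) : (addConGen (Rel F)).Quotient →+ s.pt :=
  (addConGen (Rel F)).lift
    (Multiset.sumAddMonoidHom.comp (Multiset.mapAddMonoidHom fun p => s.ι.app p.1 p.2)) (by
      refine AddCon.addConGen_le.2 fun x y h => ?_
      cases h with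
      | zero j => simp [AddCon.ker_rel]
      | add j x y => simp [AddCon.ker_rel]
      | map f x => simp [AddCon.ker_rel])

theorem desc_mk (s : Cocone F) (j : J) (x : F.obj j) :
    desc s ((addConGen (Rel F)).mk' {⟨j, x⟩}) = s.ι.app j x := by
  refine (AddCon.lift_mk' _ _).trans ?_
  simp

/-- The cocone `cocone F` is a colimit. -/
noncomputable def isColimit : IsColimit (cocone F) where
  desc s := AddCommMonCat.ofHom (desc s)
  fac s j := by
    ext x
    exact desc_mk F s j x
  uniq s m hm := by
    apply AddCommMonCat.hom_ext
    refine AddCon.hom_ext (Multiset.addHom_ext fun p => ?_)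
    exact (ConcreteCategory.congr_hom (hm p.1) p.2).trans (desc_mk F s p.1 p.2).symm

end AddCommMonColimit

instance : HasColimits AddCommMonCat.{u} where
  has_colimits_of_shape _ _ :=
    { has_colimit := fun F =>
        HasColimit.mk ⟨AddCommMonColimit.cocone F, AddCommMonColimit.isColimit F⟩ }

/-! ### Additive functions on Serre quotients -/

/-! Two facts carry the proof.

Topology: `span X` is the least point of `basicOpen X`, and open sets are closed under enlarging the
Serre subcategory. So `basicOpen X` lies in an open set as soon as `span X` does
(`basicOpen_le_iff`), and any covering of it has a member containing all of it. Strong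
quasi-compactness of the `U_X` and the sheaf property follow.

Algebra: an additive function on `A` vanishing on `S` is additive on `A/S` (`descend`), so maps out
of `M(A/S)` can be built from functions on the objects of `A`. With `S` the zero objects this gives
`M(A) ≅ M(A/0)`, which is the monoid of global sections because `U_0` is the whole space. For a
point `S`, the germ at `S` of the global section given by `[X]` vanishes if `X ∈ S`, since that
section is already zero on `U_X`. Descending this germ map to `A/S` gives the inverse of the map
from the stalk to `M(A/S)`. -/

namespace IsAdditiveFunction

variable {C : Type u} [Category.{v} C] [Abelian C] {M : Type w} [AddCommMonoid M] {f : C → M}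

theorem comp_addMonoidHom {N : Type*} [AddCommMonoid N] (hf : IsAdditiveFunction f) (φ : M →+ N) :
    IsAdditiveFunction fun X => φ (f X) where
  zero X hX := by rw [hf.zero X hX, map_zero]
  shortExact S hS := by rw [hf.shortExact S hS, map_add]

theorem eq_add_cokernel (hf : IsAdditiveFunction f) {X Y : C} (i : X ⟶ Y) [Mono i] :
    f Y = f X + f (cokernel i) :=
  hf.shortExact (ShortComplex.mk i (cokernel.π i) (cokernel.condition i))
    { exact := ShortComplex.exact_cokernel i }

theorem eq_kernel_add (hf : IsAdditiveFunction f) {X Y : C} (p : X ⟶ Y) [Epi p] :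
    f X = f (kernel p) + f Y :=
  hf.shortExact (ShortComplex.mk (kernel.ι p) p (kernel.condition p))
    { exact := ShortComplex.exact_kernel p }

theorem eq_of_iso (hf : IsAdditiveFunction f) {X Y : C} (e : X ≅ Y) : f X = f Y := by
  rw [hf.eq_kernel_add e.hom, hf.zero _ (isZero_kernel_of_mono e.hom), zero_add]

theorem eq_kernel_add_image (hf : IsAdditiveFunction f) {X Y : C} (g : X ⟶ Y) :
    f X = f (kernel g) + f (Abelian.image g) := by
  rw [hf.eq_add_cokernel (kernel.ι g), hf.eq_of_iso (Abelian.coimageIsoImage g)]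

theorem eq_image_add_cokernel (hf : IsAdditiveFunction f) {X Y : C} (g : X ⟶ Y) :
    f Y = f (Abelian.image g) + f (cokernel g) :=
  hf.eq_kernel_add (cokernel.π g)

variable {S : Serre C}

theorem eq_of_isoModSerre (hf : IsAdditiveFunction f) (hS : ∀ X, S.prop X → f X = 0)
    {X Y : C} (g : X ⟶ Y) (hg : S.prop.isoModSerre g) : f X = f Y := by
  rw [hf.eq_kernel_add_image g, hf.eq_image_add_cokernel g, hS _ hg.1, hS _ hg.2, zero_add,
    add_zero]

/-- The isomorphism is represented by a roof `X ⟶ Y' ⟵ Y`. Both legs become invertible in the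
quotient, so both have kernel and cokernel in `S`, and `f` takes the same value at their ends. -/
theorem eq_of_quotFunctor_iso (hf : IsAdditiveFunction f) (hS : ∀ X, S.prop X → f X = 0)
    {X Y : C} (e : S.quotFunctor.obj X ≅ S.quotFunctor.obj Y) : f X = f Y := by
  obtain ⟨φ, hφ⟩ := Localization.exists_leftFraction S.quotFunctor S.prop.isoModSerre e.hom
  have := Localization.inverts S.quotFunctor S.prop.isoModSerre φ.s φ.hs
  have h := φ.map_comp_map_s S.quotFunctor (Localization.inverts _ _)
  rw [← hφ] at h
  have hi : IsIso (S.quotFunctor.map φ.f) := by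
    rw [← h]
    infer_instance
  rw [ObjectProperty.SerreClassLocalization.isIso_map_iff S.quotFunctor S.prop] at hi
  rw [hf.eq_of_isoModSerre hS φ.f hi, hf.eq_of_isoModSerre hS φ.s φ.hs]

/-- An additive function on an abelian category which vanishes on a Serre subcategory descends to
the quotient category. -/
theorem descend (hf : IsAdditiveFunction f) (hS : ∀ X, S.prop X → f X = 0) :
    IsAdditiveFunction fun X : S.AbQuot => f X.as.obj where
  zero X hX := by
    obtain ⟨Y, rfl⟩ := S.obj_surjective X
    exact hS _ ((ObjectProperty.SerreClassLocalization.isZero_obj_iff S.quotFunctor S.prop Y).1 hX)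
  shortExact := by
    rintro ⟨i, p, w⟩ hE
    rename_i X Y Z
    obtain ⟨X, rfl⟩ := S.obj_surjective X
    obtain ⟨Y, rfl⟩ := S.obj_surjective Y
    obtain ⟨Z, rfl⟩ := S.obj_surjective Z
    have := hE.mono_f
    have := hE.epi_g
    dsimp only at this
    -- Only the epimorphism `p` is lifted to `A`, as a roof; `X` is then recovered as its kernel.
    obtain ⟨φ, hφ⟩ := Localization.exists_leftFraction S.quotFunctor S.prop.isoModSerre p
    have hs := Localization.inverts S.quotFunctor S.prop.isoModSerre φ.s φ.hs
    have h := φ.map_comp_map_s S.quotFunctor (Localization.inverts _ _)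
    rw [← hφ] at h
    have he : Epi (S.quotFunctor.map φ.f) := by
      rw [← h]
      exact epi_comp _ _
    rw [ObjectProperty.SerreClassLocalization.epi_map_iff S.quotFunctor S.prop] at he
    -- Composing `p` with the isomorphism `Q(φ.s)` does not change its kernel, and `Q` preserves
    -- kernels.
    have e : S.quotFunctor.obj X ≅ S.quotFunctor.obj (kernel φ.f) :=
      IsLimit.conePointUniqueUpToIso hE.fIsKernel (kernelIsKernel p) ≪≫
        (kernelCompMono p (S.quotFunctor.map φ.s)).symm ≪≫ kernelIsoOfEq h ≪≫
          (PreservesKernel.iso S.quotFunctor φ.f).symm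
    change f Y = f X + f Z
    -- `f Z` equals `f` of the apex of the roof, hence `f (image φ.f)`, because `cokernel φ.f` lies
    -- in `S`.
    rw [hf.eq_of_quotFunctor_iso hS e, hf.eq_of_isoModSerre hS φ.s φ.hs,
      hf.eq_image_add_cokernel φ.f, hS _ he, add_zero, ← hf.eq_kernel_add_image]

end IsAdditiveFunction

/-! ### The topology of the space of Serre subcategories -/

namespace Serre

variable {A : Type u} [Category.{v} A] [Abelian A]

theorem isOpen_iff (U : Set (Serre A)) :
    IsOpen U ↔ ∃ 𝒳 : ObjectProperty A, U = {S | ∃ X, 𝒳 X ∧ S.prop X} := by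
  rw [← isClosed_compl_iff, isClosed_iff]
  refine exists_congr fun 𝒳 => ?_
  have h : (zeroLocus 𝒳)ᶜ = {S | ∃ X, 𝒳 X ∧ S.prop X} := by
    ext S
    simp [zeroLocus]
  rw [eq_compl_comm, h]

theorem exists_mem_basicOpen_le {U : Opens (Serre A)} {S : Serre A} (hS : S ∈ U) :
    ∃ X : A, S ∈ basicOpen X ∧ basicOpen X ≤ U := by
  obtain ⟨𝒳, h𝒳⟩ := (isOpen_iff (U : Set (Serre A))).1 U.isOpen
  have hS' : S ∈ (U : Set (Serre A)) := hS
  rw [h𝒳] at hS'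
  obtain ⟨X, hX, hSX⟩ := hS'
  refine ⟨X, hSX, fun T hT => ?_⟩
  change T ∈ (U : Set (Serre A))
  rw [h𝒳]
  exact ⟨X, hX, hT⟩

/-- If `U` contains `span X`, it contains some `U_Y` with `Y ∈ span X`; every Serre subcategory
containing `X` contains this `Y`. -/
theorem basicOpen_le_iff {X : A} {U : Opens (Serre A)} : basicOpen X ≤ U ↔ span X ∈ U := by
  refine ⟨fun h => h (mem_span X), fun h => ?_⟩
  obtain ⟨Y, hY, hYU⟩ := exists_mem_basicOpen_le h
  exact le_trans (fun S hS => hY S hS) hYU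

theorem exists_basicOpen_le_of_mem {X Y : A} {S : Serre A} (hX : S ∈ basicOpen X)
    (hY : S ∈ basicOpen Y) :
    ∃ Z : A, S ∈ basicOpen Z ∧ basicOpen Z ≤ basicOpen X ∧ basicOpen Z ≤ basicOpen Y := by
  obtain ⟨Z, hZ, hZ'⟩ := exists_mem_basicOpen_le (U := basicOpen X ⊓ basicOpen Y) ⟨hX, hY⟩
  exact ⟨Z, hZ, hZ'.trans inf_le_left, hZ'.trans inf_le_right⟩

theorem basicOpen_eq_top {X : A} (hX : IsZero X) : basicOpen X = ⊤ :=
  top_unique fun S _ => S.prop.prop_of_isZero hX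

theorem isStronglyQuasiCompactSpace_iff (U : Opens (Serre A)) :
    IsStronglyQuasiCompactSpace U ↔ ∃ X : A, basicOpen X = U := by
  constructor
  · intro h
    -- The covering of `U` by all basic open sets inside it.
    have := h {V | ∃ X : A, basicOpen X ≤ U ∧ V = {S : U | S.1 ∈ basicOpen X}} (by
        rintro _ ⟨X, -, rfl⟩
        exact (basicOpen X).isOpen.preimage continuous_subtype_val) (by
        refine Set.eq_univ_of_forall fun S => ?_
        obtain ⟨X, hX, hXU⟩ := exists_mem_basicOpen_le S.2
        exact ⟨_, ⟨X, hXU, rfl⟩, hX⟩)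
    obtain ⟨X, hX, h⟩ := this
    refine ⟨X, le_antisymm hX fun S hS => ?_⟩
    have : (⟨S, hS⟩ : U) ∈ (Set.univ : Set U) := Set.mem_univ _
    rw [h] at this
    exact this
  · rintro ⟨X, rfl⟩ 𝒰 h𝒰 hcov
    have : (⟨span X, mem_span X⟩ : basicOpen X) ∈ ⋃₀ 𝒰 := by
      rw [hcov]
      exact Set.mem_univ _
    obtain ⟨V, hV, hXV⟩ := this
    obtain ⟨W, hW, rfl⟩ := isOpen_induced_iff.1 (h𝒰 V hV)
    convert hV
    refine (Set.eq_univ_of_forall fun S => ?_).symm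
    exact basicOpen_le_iff (U := ⟨W, hW⟩).2 hXV S.2

theorem isBasis_basicOpen : Opens.IsBasis (Set.range (basicOpen (A := A))) := by
  rw [Opens.isBasis_iff_nbhd]
  intro U S hS
  obtain ⟨X, hX, hXU⟩ := exists_mem_basicOpen_le hS
  exact ⟨_, ⟨X, rfl⟩, hX, hXU⟩

end Serre

namespace Serre

variable {A : Type u} [Category.{v} A] [Abelian A]

/-! ### The sheaf property and the values on the basis -/

theorem isSheaf_monoidPresheaf : (monoidPresheaf A).IsSheaf := by
  rw [TopCat.Presheaf.isSheaf_iff_isSheaf_comp (forget AddCommMonCat.{u})]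
  refine TopCat.Presheaf.isSheaf_of_isSheafUniqueGluing_types _ fun ι U sf hsf => ?_
  let t (i : ι) : sections (U i) := sf i
  have hsf' (i j : ι) (X : A) (hi : basicOpen X ≤ U i) (hj : basicOpen X ≤ U j) :
      (t i).1 ⟨X, hi⟩ = (t j).1 ⟨X, hj⟩ :=
    congrFun (congrArg Subtype.val (hsf i j)) ⟨X, le_inf hi hj⟩
  -- Each basic open subset of the union lies in a single `U i`, so the component at `X` of the
  -- glued section is read off from `t i`; by `hsf'` the choice of `i` is irrelevant.
  have hmem (X : {X : A // basicOpen X ≤ iSup U}) : ∃ i, basicOpen X.1 ≤ U i := by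
    obtain ⟨i, hi⟩ := Opens.mem_iSup.1 (basicOpen_le_iff.1 X.2)
    exact ⟨i, basicOpen_le_iff.2 hi⟩
  choose i hi using hmem
  refine ⟨⟨fun X => (t (i X)).1 ⟨X.1, hi X⟩, fun X Y h => ?_⟩, fun j => ?_, fun s hs => ?_⟩
  · exact ((t (i X)).2 ⟨X.1, hi X⟩ ⟨Y.1, h.trans (hi X)⟩ h).trans
      (hsf' (i X) (i Y) Y.1 (h.trans (hi X)) (hi Y))
  · exact Subtype.ext (funext fun X => hsf' _ _ _ _ _)
  · refine Subtype.ext (funext fun X => ?_)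
    exact congrFun (congrArg Subtype.val (hs (i X))) ⟨X.1, hi X⟩

/-- Sections over `V` are determined by their component at `X` if `U_X = V`. -/
theorem bijective_eval {V : Opens (Serre A)} (X : A) (hX : basicOpen X = V) :
    Function.Bijective fun s : sections V => s.1 ⟨X, hX.le⟩ := by
  constructor
  · intro s t hst
    refine Subtype.ext (funext fun Y => ?_)
    have hY : basicOpen Y.1 ≤ basicOpen X := Y.2.trans hX.ge
    rw [← s.2 ⟨X, hX.le⟩ Y hY, ← t.2 ⟨X, hX.le⟩ Y hY]
    exact congrArg _ hst
  · intro x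
    -- Since `U_X` is the largest basic open set in `V`, restricting `x` to the smaller ones gives a
    -- compatible family.
    refine ⟨⟨fun Y => monoidMap (span_le_span (Y.2.trans hX.ge)) x, fun Y Z h => ?_⟩, ?_⟩
    · exact DFunLike.congr_fun (monoidMap_comp _ _) x
    · exact DFunLike.congr_fun (monoidMap_self _) x

instance (X : (Basis A)ᵒᵖ) : IsIso ((restrictionToBasis A).app X) :=
  (ConcreteCategory.isIso_iff_bijective _).2 (bijective_eval (A := A) X.unop rfl)

instance isIso_restrictionToBasis : IsIso (restrictionToBasis A) :=
  NatIso.isIso_of_isIso_app _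

/-! ### Global sections -/

/-- The function `of` vanishes on `S`, so it descends to `A/S`; this gives the inverse. -/
theorem bijective_map_quotFunctor (S : Serre A) (hS : ∀ X, S.prop X → IsZero X) :
    Function.Bijective (GrothendieckMonoid.map S.quotFunctor) := by
  let r : GrothendieckMonoid S.AbQuot →+ GrothendieckMonoid A :=
    GrothendieckMonoid.lift _ (GrothendieckMonoid.of_isAdditive.descend (S := S)
      fun X hX => GrothendieckMonoid.of_isAdditive.zero _ (hS X hX))
  have h₁ : r.comp (GrothendieckMonoid.map S.quotFunctor) = AddMonoidHom.id _ :=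
    GrothendieckMonoid.hom_ext fun X => by
      rw [AddMonoidHom.comp_apply, GrothendieckMonoid.map_of]
      exact GrothendieckMonoid.lift_of _ _ _
  have h₂ : (GrothendieckMonoid.map S.quotFunctor).comp r = AddMonoidHom.id _ :=
    GrothendieckMonoid.hom_ext fun X => by
      rw [AddMonoidHom.comp_apply, GrothendieckMonoid.lift_of, GrothendieckMonoid.map_of]
      rfl
  exact Function.bijective_iff_has_inverse.2
    ⟨r, DFunLike.congr_fun h₁, DFunLike.congr_fun h₂⟩

theorem monoidMap_comp_map_quotFunctor {S T : Serre A} (h : S.prop ≤ T.prop) :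
    (monoidMap h).comp (GrothendieckMonoid.map S.quotFunctor) =
      GrothendieckMonoid.map T.quotFunctor :=
  GrothendieckMonoid.hom_ext fun X => by
    rw [AddMonoidHom.comp_apply, GrothendieckMonoid.map_of, monoidMap_of,
      GrothendieckMonoid.map_of]

/-- The homomorphism from `M(A)` to the sections over `V`, induced by the quotient functors. -/
noncomputable def toSections (V : Opens (Serre A)) : GrothendieckMonoid A →+ sections V where
  toFun x := ⟨fun X => GrothendieckMonoid.map (span X.1).quotFunctor x, fun _ _ h =>
    DFunLike.congr_fun (monoidMap_comp_map_quotFunctor (span_le_span h)) x⟩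
  map_zero' := Subtype.ext (funext fun _ => map_zero _)
  map_add' _ _ := Subtype.ext (funext fun _ => map_add _ _ _)

open ZeroObject in
theorem bijective_toSections_top : Function.Bijective (toSections (⊤ : Opens (Serre A))) := by
  have h := bijective_eval (0 : A) (basicOpen_eq_top (isZero_zero A))
  rw [← Function.Bijective.of_comp_iff' h]
  refine bijective_map_quotFunctor (span (0 : A)) fun X hX => ?_
  -- The zero objects form a Serre subcategory containing `0`, so they contain `span 0`.
  exact hX ⟨IsZero, inferInstance⟩ (isZero_zero A)

/-- The canonical isomorphism from `M(A)` to the monoid of global sections. -/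
noncomputable def globalSectionsIso :
    AddCommMonCat.of (GrothendieckMonoid A) ≅ (monoidPresheaf A).obj (op ⊤) :=
  (AddEquiv.ofBijective (toSections (⊤ : Opens (Serre A)))
    bijective_toSections_top).toAddCommMonCatIso

/-! ### Stalks -/

/-- The value at `S` of a section over a neighbourhood of `S`. -/
noncomputable def valueAt (S : Serre A) {V : Opens (Serre A)} (hS : S ∈ V) :
    sections V →+ GrothendieckMonoid S.AbQuot where
  toFun s := monoidMap (span_le (exists_mem_basicOpen_le hS).choose_spec.1)
    (s.1 ⟨_, (exists_mem_basicOpen_le hS).choose_spec.2⟩)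
  map_zero' := map_zero _
  map_add' _ _ := map_add _ _ _

/-- Makes `valueAt` independent of the chosen basic neighbourhood: two of them are compared on a
common smaller one. -/
theorem monoidMap_span_le_eq {S : Serre A} {V : Opens (Serre A)} (s : sections V) 
    (X Y : {X : A // basicOpen X ≤ V})
    (hX : S ∈ basicOpen X.1) (hY : S ∈ basicOpen Y.1) :
    monoidMap (span_le hX) (s.1 X) = monoidMap (span_le hY) (s.1 Y) := by
  obtain ⟨Z, hZ, hZX, hZY⟩ := exists_basicOpen_le_of_mem hX hY
  have h (W) (hW : S ∈ basicOpen W.1) (hZW : basicOpen Z ≤ basicOpen W.1) :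
      monoidMap (span_le hW) (s.1 W) =
        monoidMap (span_le hZ) (s.1 ⟨Z, hZW.trans W.2⟩) := by
    rw [← s.2 W ⟨Z, hZW.trans W.2⟩ hZW]
    exact (DFunLike.congr_fun (monoidMap_comp (span_le_span hZW) (span_le hZ)) _).symm
  rw [h X hX hZX, h Y hY hZY]

theorem valueAt_apply {S : Serre A} {V : Opens (Serre A)} (hS : S ∈ V) (s : sections V) (X : {X : A // basicOpen X ≤ V})
    (hX : S ∈ basicOpen X.1) : valueAt S hS s = monoidMap (span_le hX) (s.1 X) :=
  monoidMap_span_le_eq s ⟨_, (exists_mem_basicOpen_le hS).choose_spec.2⟩ X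
    (exists_mem_basicOpen_le hS).choose_spec.1 hX

theorem valueAt_toSections {S : Serre A} {V : Opens (Serre A)} (hS : S ∈ V)
    (x : GrothendieckMonoid A) :
    valueAt S hS (toSections V x) = GrothendieckMonoid.map S.quotFunctor x := by
  obtain ⟨X, hX, hXV⟩ := exists_mem_basicOpen_le hS
  rw [valueAt_apply hS _ ⟨X, hXV⟩ hX]
  exact DFunLike.congr_fun (monoidMap_comp_map_quotFunctor _) x

theorem valueAt_restrict {S : Serre A} {V W : Opens (Serre A)} (hS : S ∈ W) (h : W ≤ V)
    (s : sections V) : valueAt S hS (sectionsRestrict h s) = valueAt S (h hS) s := by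
  obtain ⟨X, hX, hXW⟩ := exists_mem_basicOpen_le hS
  rw [valueAt_apply hS _ ⟨X, hXW⟩ hX, valueAt_apply (h hS) _ ⟨X, hXW.trans h⟩ hX]
  rfl

/-- The canonical homomorphism from the stalk at `S` to `M(A/S)`. -/
noncomputable def stalkHom (S : Serre A) :
    TopCat.Presheaf.stalk (monoidPresheaf A) S ⟶
      AddCommMonCat.of (GrothendieckMonoid S.AbQuot) :=
  colimit.desc ((OpenNhds.inclusion (X := TopCat.of (Serre A)) S).op ⋙ monoidPresheaf A)
    { pt := AddCommMonCat.of (GrothendieckMonoid S.AbQuot)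
      ι :=
        { app := fun V => AddCommMonCat.ofHom (valueAt S V.unop.2)
          naturality := fun V W f => by
            ext s
            exact valueAt_restrict W.unop.2 (leOfHom f.unop) s } }

theorem germ_stalkHom (S : Serre A) (V : Opens (TopCat.of (Serre A))) (hS : S ∈ V) :
    (monoidPresheaf A).germ V S hS ≫ stalkHom S = AddCommMonCat.ofHom (valueAt S hS) :=
  colimit.ι_desc _ _

theorem germ_toSections (S : Serre A) (V : Opens (TopCat.of (Serre A))) (hS : S ∈ V)
    (x : GrothendieckMonoid A) :
    (monoidPresheaf A).germ V S hS (toSections V x) =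
      (monoidPresheaf A).germ ⊤ S trivial (toSections ⊤ x) :=
  (monoidPresheaf A).germ_res_apply (homOfLE le_top) S hS (toSections ⊤ x)

/-- The canonical homomorphism from `M(A)` to the stalk at `S`. -/
noncomputable def toStalk (S : Serre A) :
    GrothendieckMonoid A →+ ↑(TopCat.Presheaf.stalk (monoidPresheaf A) S : AddCommMonCat.{u}) :=
  ((monoidPresheaf A).germ ⊤ S trivial).hom.comp (toSections ⊤)

/-- As `X ∈ S`, the set `U_X` is a neighbourhood of `S`. The section given by `[X]` vanishes there,
because `X` becomes zero in `A/⟨X⟩` and sections over `U_X` are determined by their component at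
`X`. -/
theorem toStalk_of_eq_zero (S : Serre A) (X : A) (hX : S.prop X) :
    toStalk S (.of X) = 0 := by
  refine (germ_toSections S (basicOpen X) hX _).symm.trans ?_
  have : toSections (basicOpen X) (.of X) = 0 := by
    refine (bijective_eval X rfl).1 ?_
    change GrothendieckMonoid.map (span X).quotFunctor (.of X) = 0
    rw [GrothendieckMonoid.map_of]
    exact GrothendieckMonoid.of_isAdditive.zero _
      ((ObjectProperty.SerreClassLocalization.isZero_obj_iff _ (span X).prop X).2 (mem_span X))
  rw [this]
  exact map_zero ((monoidPresheaf A).germ (basicOpen X) S hX).hom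

/-- The inverse of the canonical homomorphism from the stalk at `S` to `M(A/S)`. -/
noncomputable def stalkInv (S : Serre A) :
    GrothendieckMonoid S.AbQuot →+ ↑(TopCat.Presheaf.stalk (monoidPresheaf A) S : AddCommMonCat.{u}) :=
  GrothendieckMonoid.lift _
    ((GrothendieckMonoid.of_isAdditive.comp_addMonoidHom (toStalk S)).descend
      (toStalk_of_eq_zero S))

theorem stalkInv_of (S : Serre A) (X : A) :
    stalkInv S (.of (S.quotFunctor.obj X)) = toStalk S (.of X) :=
  GrothendieckMonoid.lift_of _ _ _

theorem stalkInv_comp_monoidMap (S : Serre A) (X : A) (hX : S ∈ basicOpen X)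
    (s : sections (basicOpen X)) :
    stalkInv S (monoidMap (span_le hX) (s.1 ⟨X, le_refl _⟩)) =
      (monoidPresheaf A).germ (basicOpen X) S hX s := by
  -- Through `e`, the claim becomes an equality of homomorphisms out of `M(A/⟨X⟩)`, which can be
  -- checked on classes of objects of `A`.
  let e : sections (basicOpen X) ≃+ GrothendieckMonoid (span X).AbQuot :=
    AddEquiv.ofBijective
      (((restrictionToBasis A).app (op X)).hom : sections (basicOpen X) →+ _)
      (bijective_eval X rfl)
  have h : (stalkInv S).comp (monoidMap (span_le hX)) =
      ((monoidPresheaf A).germ (basicOpen X) S hX).hom.comp e.symm.toAddMonoidHom := by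
    refine GrothendieckMonoid.hom_ext fun Y => ?_
    obtain ⟨Y, rfl⟩ := obj_surjective _ Y
    rw [AddMonoidHom.comp_apply, monoidMap_of, stalkInv_of]
    have : e.symm (.of ((span X).quotFunctor.obj Y)) = toSections (basicOpen X) (.of Y) := by
      rw [AddEquiv.symm_apply_eq]
      exact (GrothendieckMonoid.map_of _ _).symm
    refine (germ_toSections S (basicOpen X) hX _).symm.trans ?_
    rw [← this]
    rfl
  refine (DFunLike.congr_fun h (e s)).trans ?_
  exact congrArg ((monoidPresheaf A).germ (basicOpen X) S hX) (e.symm_apply_apply s)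

/-- The canonical isomorphism from the stalk at `S` to `M(A/S)`. -/
noncomputable def stalkIso (S : Serre A) :
    TopCat.Presheaf.stalk (monoidPresheaf A) S ≅
      AddCommMonCat.of (GrothendieckMonoid S.AbQuot) where
  hom := stalkHom S
  inv := AddCommMonCat.ofHom (stalkInv S)
  hom_inv_id := by
    refine TopCat.Presheaf.stalk_hom_ext _ fun V hS => ?_
    ext s
    -- Shrinking to a basic neighbourhood changes neither the germ nor the value at `S`.
    obtain ⟨X, hX, hXV⟩ := exists_mem_basicOpen_le (U := V) hS
    refine (congrArg (stalkInv S) (ConcreteCategory.congr_hom (germ_stalkHom S V hS) s)).trans ?_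
    refine Eq.trans ?_ ((monoidPresheaf A).germ_res_apply (homOfLE hXV) S hX s)
    refine Eq.trans ?_ (stalkInv_comp_monoidMap S X hX (sectionsRestrict hXV s))
    exact congrArg (stalkInv S) (valueAt_apply hS s ⟨X, hXV⟩ hX)
  inv_hom_id := by
    refine AddCommMonCat.hom_ext (GrothendieckMonoid.hom_ext fun X => ?_)
    obtain ⟨X, rfl⟩ := obj_surjective _ X
    refine (congrArg (stalkHom S) (stalkInv_of S X)).trans ?_
    refine (ConcreteCategory.congr_hom (germ_stalkHom S ⊤ trivial) (toSections ⊤ (.of X))).trans ?_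
    exact (valueAt_toSections (S := S) (V := ⊤) trivial (.of X)).trans
      (GrothendieckMonoid.map_of S.quotFunctor X)

end Serre

theorem mainTheorem10 {A : Type u} [Category.{v} A] [Abelian A] :
    -- the strongly quasi-compact open subsets are the `U_X`, and they form a basis
    (∀ U : Opens (Serre A),
      IsStronglyQuasiCompactSpace U ↔ ∃ X : A, Serre.basicOpen X = U) ∧
    Opens.IsBasis {U : Opens (Serre A) | IsStronglyQuasiCompactSpace U} ∧
    -- `M_A` is a sheaf
    (Serre.monoidPresheaf A).IsSheaf ∧
    -- it extends the presheaf `U_X ↦ M(A/⟨X⟩)` on the basis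
    IsIso (Serre.restrictionToBasis A) ∧
    -- its monoid of global sections is `M(A)`, through the canonical map
    (∃ e : AddCommMonCat.of (GrothendieckMonoid A) ≅ (Serre.monoidPresheaf A).obj (op ⊤),
      ∀ X : A,
        e.hom ≫ (Serre.monoidPresheaf A).map (homOfLE (le_top : Serre.basicOpen X ≤ ⊤)).op ≫
            (Serre.restrictionToBasis A).app (op X) =
          AddCommMonCat.ofHom (GrothendieckMonoid.map (Serre.span X).quotFunctor)) ∧
    -- its stalk at `S` is `M(A/S)`, through the canonical map
    (∀ S : Serre A,
      ∃ e : TopCat.Presheaf.stalk (Serre.monoidPresheaf A) S ≅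
          AddCommMonCat.of (GrothendieckMonoid S.AbQuot),
        ∀ (X : A) (hX : S ∈ Serre.basicOpen X),
          (Serre.monoidPresheaf A).germ (Serre.basicOpen X) S hX ≫ e.hom =
            (Serre.restrictionToBasis A).app (op X) ≫
              AddCommMonCat.ofHom (Serre.monoidMap (Serre.span_le hX))) := by
  refine ⟨Serre.isStronglyQuasiCompactSpace_iff, ?_, Serre.isSheaf_monoidPresheaf,
    Serre.isIso_restrictionToBasis, ⟨Serre.globalSectionsIso, fun _ => rfl⟩,
    fun S => ⟨Serre.stalkIso S, fun X hX => ?_⟩⟩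
  · convert! Serre.isBasis_basicOpen (A := A) using 1
    exact Set.ext Serre.isStronglyQuasiCompactSpace_iff
  · refine (Serre.germ_stalkHom S (Serre.basicOpen X) hX).trans ?_
    ext s
    exact Serre.valueAt_apply hX s ⟨X, le_refl _⟩ hX
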